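/- Let $n\ge 1$ and $j\ge 0$ be integers. Let $\mathfrak g^{(n,j)}_{\mathbb C}$ be the complex Jacobi Lie algebra, i.e. the Lie algebra (under the commutator bracket) of all complex matrices of the form $$ \begin{pmatrix} A&0&B&{}^t u\\ v&0&u&Z\\ C&0&-{}^tA&-{}^t v\\ 0&0&0&0\end{pmatrix},\qquad A,B,C\in \mathrm{Mat}_{n\times n}(\mathbb C),\ B={}^tB,\ C={}^tC,\ u,v\in\mathrm{Mat}_{j\times n}(\mathbb C),\ Z={}^tZ\in\mathrm{Mat}_{j\times j}(\mathbb C). $$ Write $\begin{pmatrix}A&B\\ C&-{}^tA\end{pmatrix}$ for such a matrix with $u=v=0$, $Z=0$, and $[v,u,Z]$ for such a matrix with $A=B=C=0$. Put $N=n+j$, let $E_{a,b}$ be the elementary $2N\times 2N$ matrices, and let $$\hat M_{+,n+j}=\det\bigl(E_{a,N+b}+E_{b,N+a}\bigr)_{1\le a,b\le N}\in U(\mathfrak g^{(n,j)}_{\mathbb C}),$$ a determinant whose entries commute with one another. Let $V$ be a $\mathfrak g^{(n,j)}_{\mathbb C}$-module and let $\mathcal M\in\mathrm{Mat}_{j\times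 j}(\mathbb C)$ be symmetric. Say that $v\in V$ is * holomorphic if $[\lambda,0,0]\,v=0$ for all $\lambda\in \mathrm{Mat}_{j\times n}(\mathbb C)$ and $\begin{pmatrix}0&0\\X&0\end{pmatrix}v=0$ for all symmetric $X\in\mathrm{Mat}_{n\times n}(\mathbb C)$; * of index $\mathcal M$ if $[0,0,\zeta]\,v=2\pi i\,\mathrm{Tr}(\zeta\mathcal M)\,v$ for all symmetric $\zeta\in\mathrm{Mat}_{j\times j}(\mathbb C)$; * of weight $k\in\mathbb C$ if $\begin{pmatrix}A&0\\0&-{}^tA\end{pmatrix}v=k\,\mathrm{Tr}(A)\,v$ for all $A\in\mathfrak{gl}(n,\mathbb C)$. (In particular, the zero vector has all three properties.) **Theorem.** Let $r\ge 0$ be an integer and let $v_0\in V$ be holomorphic, of index $\mathcal M$ and of weight $-r+\frac{n+j+1}2$. Then $\hat M_{+,n+j}^{\,r}v_0$ is holomorphic, of index $\mathcal M$ and of weight $r+\frac{n+j+1}2$. Moreover, for every integer $k\ge 0$ with $k\ne r$, the vector $\hat M_{+,n+j}^{\,k}v_0$ is of weight $-r+\frac{n+j+1}2+2k$ and of index $\mathcal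 M$; and if in addition $k\ge 1$, $\det\mathcal M\neq 0$ (for instance, $\mathcal M$ real and positive definite) and $\hat M_{+,n+j}^{\,k}v_0\ne 0$, then $\hat M_{+,n+j}^{\,k}v_0$ is not holomorphic. -/

import Mathlib

open Matrix

attribute [local instance 100] LieRing.ofAssociativeRing

noncomputable section

namespace Jacobi

/-- Index set of the rows and columns of a `2(n+j) × 2(n+j)` matrix, in the order `n, j, n, j`. -/
abbrev Idx (n j : ℕ) : Type := (Fin n ⊕ Fin j) ⊕ (Fin n ⊕ Fin j)

/-- The block matrix
```
  A   0    B    uᵀ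
  v   0    u    Z
  C   0  -Aᵀ  -vᵀ
  0   0    0    0
```
-/
def blockMatrix {n j : ℕ} (A B C : Matrix (Fin n) (Fin n) ℂ) (v u : Matrix (Fin j) (Fin n) ℂ)
    (Z : Matrix (Fin j) (Fin j) ℂ) : Matrix (Idx n j) (Idx n j) ℂ :=
  fromBlocks (fromBlocks A 0 v 0) (fromBlocks B uᵀ u Z)
    (fromBlocks C 0 0 0) (fromBlocks (-Aᵀ) (-vᵀ) 0 0)

/-- The complex Jacobi Lie algebra `𝔤^{(n,j)}`, realised inside the matrices of size `2(n+j)`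
(with the commutator bracket). -/
def jacobiLieAlgebra (n j : ℕ) : LieSubalgebra ℂ (Matrix (Idx n j) (Idx n j) ℂ) where
  carrier := {X | ∃ (A B C : Matrix (Fin n) (Fin n) ℂ) (v u : Matrix (Fin j) (Fin n) ℂ)
    (Z : Matrix (Fin j) (Fin j) ℂ), B.IsSymm ∧ C.IsSymm ∧ Z.IsSymm ∧ X = blockMatrix A B C v u Z}
  zero_mem' := ⟨0, 0, 0, 0, 0, 0, by simp [IsSymm], by simp [IsSymm], by simp [IsSymm],
    by simp [blockMatrix]⟩
  add_mem' := by
    rintro _ _ ⟨A, B, C, v, u, Z, hB, hC, hZ, rfl⟩ ⟨A', B', C', v', u', Z', hB', hC', hZ', rfl⟩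
    refine ⟨A + A', B + B', C + C', v + v', u + u', Z + Z', hB.add hB', hC.add hC', hZ.add hZ', ?_⟩
    simp [blockMatrix, fromBlocks_add, add_comm]
  smul_mem' := by
    rintro c _ ⟨A, B, C, v, u, Z, hB, hC, hZ, rfl⟩
    refine ⟨c • A, c • B, c • C, c • v, c • u, c • Z, hB.smul c, hC.smul c, hZ.smul c, ?_⟩
    simp [blockMatrix, fromBlocks_smul]
  lie_mem' := by
    rintro _ _ ⟨A, B, C, v, u, Z, hB, hC, hZ, rfl⟩ ⟨A', B', C', v', u', Z', hB', hC', hZ', rfl⟩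
    simp only [IsSymm] at *
    refine ⟨A * A' + B * C' - (A' * A + B' * C), A * B' - B * A'ᵀ - (A' * B - B' * Aᵀ),
      C * A' - Aᵀ * C' - (C' * A - A'ᵀ * C), v * A' + u * C' - (v' * A + u' * C),
      v * B' - u * A'ᵀ - (v' * B - u' * Aᵀ),
      v * u'ᵀ - u * v'ᵀ - (v' * uᵀ - u' * vᵀ), ?_, ?_, ?_, ?_⟩
    · simp [hB, hB']; abel
    · simp [hC, hC']; abel
    · simp; abel
    · simp [blockMatrix, Ring.lie_def, fromBlocks_multiply, sub_eq_add_neg, fromBlocks_add,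
        fromBlocks_neg, hB, hC, hB', hC']
      refine ⟨?_, ?_, ?_⟩ <;> abel

variable {n j : ℕ}

/-- The element of `𝔤^{(n,j)}` with the given blocks. -/
def elt (A B C : Matrix (Fin n) (Fin n) ℂ) (v u : Matrix (Fin j) (Fin n) ℂ)
    (Z : Matrix (Fin j) (Fin j) ℂ) (hB : B.IsSymm) (hC : C.IsSymm) (hZ : Z.IsSymm) :
    jacobiLieAlgebra n j :=
  ⟨blockMatrix A B C v u Z, A, B, C, v, u, Z, hB, hC, hZ, rfl⟩

/-- The element `(A, B; C, -Aᵀ)` of `𝔰𝔭(2n) ⊆ 𝔤^{(n,j)}`. -/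
def sp (A B C : Matrix (Fin n) (Fin n) ℂ) (hB : B.IsSymm) (hC : C.IsSymm) :
    jacobiLieAlgebra n j :=
  elt A B C 0 0 0 hB hC isSymm_zero

/-- The element `[v, u, Z]` of the Heisenberg subalgebra of `𝔤^{(n,j)}`. -/
def heis (v u : Matrix (Fin j) (Fin n) ℂ) (Z : Matrix (Fin j) (Fin j) ℂ) (hZ : Z.IsSymm) :
    jacobiLieAlgebra n j :=
  elt 0 0 0 v u Z isSymm_zero isSymm_zero hZ

/-- The matrix with upper right block `S` and all other blocks zero belongs to `𝔤^{(n,j)}`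
when `S` is symmetric. -/
theorem upper_mem (S : Matrix (Fin n ⊕ Fin j) (Fin n ⊕ Fin j) ℂ) (hS : S.IsSymm) :
    fromBlocks 0 S 0 0 ∈ jacobiLieAlgebra n j := by
  refine ⟨0, S.toBlocks₁₁, 0, 0, S.toBlocks₂₁, S.toBlocks₂₂, ?_, isSymm_zero, ?_, ?_⟩
  · ext a b; exact hS.apply _ _
  · ext a b; exact hS.apply _ _
  · have h : S.toBlocks₂₁ᵀ = S.toBlocks₁₂ := by ext a b; exact hS.apply _ _
    simp [blockMatrix, h, fromBlocks_toBlocks]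

/-- `E_{a,N+b} + E_{b,N+a}` with `N = n + j`, as an element of `𝔤^{(n,j)}`. -/
def raising (a b : Fin n ⊕ Fin j) : jacobiLieAlgebra n j :=
  ⟨fromBlocks 0 (Matrix.single a b 1 + Matrix.single b a 1) 0 0, upper_mem _ (by
    simp [IsSymm, transpose_single, add_comm])⟩

theorem raising_lie (a b c d : Fin n ⊕ Fin j) : ⁅raising a b, raising c d⁆ = 0 := by
  apply Subtype.ext
  simp [raising, Ring.lie_def, fromBlocks_multiply]

variable (n j) in
/-- The universal enveloping algebra of `𝔤^{(n,j)}`. -/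
abbrev U : Type := UniversalEnvelopingAlgebra ℂ (jacobiLieAlgebra n j)

/-- The matrix over `U(𝔤^{(n,j)})` whose `a, b` entry is `E_{a,N+b} + E_{b,N+a}`. -/
def raisingMatrix : Matrix (Fin n ⊕ Fin j) (Fin n ⊕ Fin j) (U n j) :=
  fun a b => UniversalEnvelopingAlgebra.ι ℂ (raising a b)

theorem raisingMatrix_commute (a b c d : Fin n ⊕ Fin j) :
    Commute (raisingMatrix a b) (raisingMatrix c d) := by
  have h := (UniversalEnvelopingAlgebra.ι ℂ).map_lie (raising a b) (raising c d)
  rw [raising_lie, map_zero, Ring.lie_def] at h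
  exact (sub_eq_zero.mp h.symm)

variable (n j) in
/-- The raising operator `M̂_{+,n+j} ∈ U(𝔤^{(n,j)})`: the determinant (Leibniz formula) of
`raisingMatrix`, whose entries commute, so that the order of the factors does not matter. -/
def raisingOp : U n j :=
  ∑ σ : Equiv.Perm (Fin n ⊕ Fin j), (Equiv.Perm.sign σ : ℤ) •
    Finset.univ.noncommProd (fun a => raisingMatrix (σ a) a)
      (fun _ _ _ _ _ => raisingMatrix_commute _ _ _ _)


/-- `v` is holomorphic: it is annihilated by all `[lam, 0, 0]` and all `(0, 0; X, 0)`. -/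
def IsHolomorphic (n j : ℕ) {V : Type*} [AddCommGroup V] [Module ℂ V]
    [LieRingModule (jacobiLieAlgebra n j) V] (v : V) : Prop :=
  (∀ lam : Matrix (Fin j) (Fin n) ℂ,
    ⁅(heis lam 0 0 isSymm_zero : jacobiLieAlgebra n j), v⁆ = 0) ∧
  (∀ (X : Matrix (Fin n) (Fin n) ℂ) (hX : X.IsSymm),
    ⁅(sp 0 0 X isSymm_zero hX : jacobiLieAlgebra n j), v⁆ = 0)

/-- `v` has index `M`: `[0, 0, ζ] v = 2πi Tr(ζ M) v` for all symmetric `ζ`. -/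
def HasIndex (n j : ℕ) {V : Type*} [AddCommGroup V] [Module ℂ V]
    [LieRingModule (jacobiLieAlgebra n j) V] (M : Matrix (Fin j) (Fin j) ℂ) (v : V) : Prop :=
  ∀ (ζ : Matrix (Fin j) (Fin j) ℂ) (hζ : ζ.IsSymm),
    ⁅(heis 0 0 ζ hζ : jacobiLieAlgebra n j), v⁆ =
      (2 * (Real.pi : ℂ) * Complex.I * (ζ * M).trace) • v

/-- `v` has weight `k`: `(A, 0; 0, -Aᵀ) v = k Tr(A) v` for all `A ∈ 𝔤𝔩(n, ℂ)`. -/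
def HasWeight (n j : ℕ) {V : Type*} [AddCommGroup V] [Module ℂ V]
    [LieRingModule (jacobiLieAlgebra n j) V] (k : ℂ) (v : V) : Prop :=
  ∀ A : Matrix (Fin n) (Fin n) ℂ,
    ⁅(sp A 0 0 isSymm_zero isSymm_zero : jacobiLieAlgebra n j), v⁆ = (k * A.trace) • v

/-- The action of `U(𝔤^{(n,j)})` on a `𝔤^{(n,j)}`-module `V`. -/
def act (n j : ℕ) {V : Type*} [AddCommGroup V] [Module ℂ V]
    [LieRingModule (jacobiLieAlgebra n j) V] [LieModule ℂ (jacobiLieAlgebra n j) V] :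
    U n j →ₐ[ℂ] Module.End ℂ V :=
  UniversalEnvelopingAlgebra.lift ℂ (LieModule.toEnd ℂ (jacobiLieAlgebra n j) V)


end Jacobi

end

/-!
The raising operators `R_{ab} = E_{a,N+b} + E_{b,N+a}` commute, so a module over `𝔤^{(n,j)}` is a
module over the polynomial ring in the entries of a generic `N × N` matrix `x`, with `x_{ab}` acting
by `R_{ab}` (`polyAct`), and `M̂_{+,n+j}` acts by `det x`.

The elements `diag(Q, -Qᵀ)` of `𝔤^{(n,j)}` are those for which `Q` is supported in the first `n`
columns. They comprise the `𝔤𝔩(n)` that defines the weight and the `[lam, 0, 0]`, and act on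
polynomials by the derivation `x ↦ Qᵀ x + x Q` (`levi_lie_polyAct`). As `det x` is a semi-invariant of
weight `2 Tr Q` (`congrDer_det`), multiplication by it raises the weight by `2` and preserves the
annihilation by all `[lam, 0, 0]`. The index is preserved because the `[0, 0, ζ]` are themselves
combinations of raising operators.

A lowering operator `X`, given by a symmetric `C`, satisfies `[X, R_{ab}] = -diag(Q, -Qᵀ)` with
`Q = (E_{ab} + E_{ba}) C`. Hence, on a vector `v` of weight `w` killed by all `[lam, 0, 0]`, one has
`X f(x) v = f(x) X v + (T f)(x) v` for an explicit second order differential operator `T`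
(`loweringOp`, `HasLeviWeight.lower_lie_polyAct`). Since `∂_{ab} det x` is an entry of the adjugate
and the adjugate transforms like `det(x) x⁻¹`, one finds
`T (det x) = -(2w - (N - 1)) Tr(C adj x)` (`loweringOp_det`). Summing over the `k` factors of
`(det x) ^ k`, with the weight increasing by `2` each time, gives
`X (det x)^k v₀ = 2 k (r - k) Tr(C adj x) (det x)^(k-1) v₀` for the weight in the theorem
(`HasLeviWeight.lower_lie_polyAct_det_pow`). This vanishes for `k = r`.

If `k ≠ r`, `k ≥ 1`, and `(det x)^k v₀` were holomorphic, all entries of the upper left `n × n` block of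
`adj x` would kill `v = (det x)^(k-1) v₀`. The lower right `j × j` block of `x` acts on `v` by the
matrix of scalars `4πi M`. When `M` is invertible, the lower left block of `x adj x = det x` forces the
lower left block of `adj x` to kill `v` too, and then a diagonal entry of the upper left block, which
exists as `n ≥ 1`, gives `(det x) v = 0` (`polyAct_det_eq_zero`).
-/

namespace Jacobi

/-! ### Derivations of determinants -/

section Determinant

variable {I R A : Type*} [CommRing R] [CommRing A] [Algebra R A]

theorem derivation_prod [DecidableEq I] (δ : Derivation R A A) (s : Finset I) (f : I → A) :
    δ (∏ i ∈ s, f i) = ∑ i ∈ s, (∏ k ∈ s.erase i, f k) * δ (f i) := by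
  induction s using Finset.induction_on with
  | empty => simp
  | insert a s ha ih =>
    rw [Finset.prod_insert ha, Finset.sum_insert ha, Finset.erase_insert ha, δ.leibniz, ih,
      add_comm, smul_eq_mul, smul_eq_mul, Finset.mul_sum]
    congr 1
    refine Finset.sum_congr rfl fun i hi => ?_
    have hne : a ≠ i := fun h => ha (h ▸ hi)
    rw [Finset.erase_insert_of_ne hne, Finset.prod_insert (by simp [ha]), mul_assoc]

/-- Jacobi's formula for the derivative of a determinant. -/
theorem derivation_det [Fintype I] [DecidableEq I] (δ : Derivation R A A) (M : Matrix I I A) :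
    δ M.det = (M.adjugate * M.map δ).trace := by
  have h : ∀ i, (M.adjugate * M.map δ) i i = (M.updateCol i fun a => δ (M a i)).det := by
    intro i
    rw [← cramer_apply, cramer_eq_adjugate_mulVec]
    rfl
  simp only [trace, diag_apply, h]
  simp only [det_apply, map_sum, Units.smul_def, map_zsmul, derivation_prod]
  rw [Finset.sum_comm]
  refine Finset.sum_congr rfl fun σ _ => ?_
  rw [← Finset.smul_sum]
  congr 1
  refine Finset.sum_congr rfl fun i _ => ?_
  rw [← Finset.prod_erase_mul _ _ (Finset.mem_univ i), updateCol_self]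
  congr 1
  refine Finset.prod_congr rfl fun k hk => ?_
  rw [updateCol_ne (Finset.ne_of_mem_erase hk)]

theorem map_derivation_mul [Fintype I] (δ : Derivation R A A) (M N : Matrix I I A) :
    (M * N).map δ = M.map δ * N + M * N.map δ := by
  ext a b
  simp only [map_apply, mul_apply, Matrix.add_apply, map_sum, δ.leibniz, smul_eq_mul,
    Finset.sum_add_distrib]
  rw [add_comm]
  congr 1
  exact Finset.sum_congr rfl fun _ _ => mul_comm _ _

end Determinant

/-! ### Polynomials in the entries of a generic matrix -/

section Generic

variable {I : Type*}

/-- The generic square matrix, whose entries are independent variables. -/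
noncomputable abbrev genMat (I : Type*) : Matrix I I (MvPolynomial (I × I) ℂ) :=
  mvPolynomialX I I ℂ

/-- A complex matrix, regarded as a matrix of constant polynomials. -/
noncomputable abbrev constMat (Q : Matrix I I ℂ) : Matrix I I (MvPolynomial (I × I) ℂ) :=
  Q.map MvPolynomial.C

/-- The derivation of the polynomial ring in the entries of the generic matrix `x` with
`x ↦ Qᵀ x + x Q`: the infinitesimal action of `Q ∈ 𝔤𝔩(I)` by `x ↦ gᵀ x g`. -/
noncomputable def congrDer [Fintype I] (Q : Matrix I I ℂ) :
    Derivation ℂ (MvPolynomial (I × I) ℂ) (MvPolynomial (I × I) ℂ) :=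
  MvPolynomial.mkDerivation ℂ fun p =>
    ((constMat Q)ᵀ * genMat I + genMat I * constMat Q) p.1 p.2

theorem genMat_map_congrDer [Fintype I] (Q : Matrix I I ℂ) :
    (genMat I).map (congrDer Q) = (constMat Q)ᵀ * genMat I + genMat I * constMat Q := by
  ext1 a b
  simp only [map_apply, mvPolynomialX_apply, congrDer, MvPolynomial.mkDerivation_X]

theorem genMat_map_pderiv [DecidableEq I] (a b : I) :
    (genMat I).map (MvPolynomial.pderiv (a, b)) = single a b 1 := by
  ext1 c d
  simp only [map_apply, mvPolynomialX_apply, MvPolynomial.pderiv_X, Pi.single_apply, single,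
    of_apply, Prod.mk.injEq, eq_comm]

theorem trace_constMat [Fintype I] (Q : Matrix I I ℂ) :
    (constMat Q).trace = MvPolynomial.C Q.trace := by
  simp [trace]

variable [Fintype I] [DecidableEq I]

theorem pderiv_det_genMat (a b : I) :
    MvPolynomial.pderiv (a, b) (genMat I).det = (genMat I).adjugate b a := by
  rw [derivation_det, genMat_map_pderiv, trace_mul_single]
  simp

/-- The determinant of the generic matrix is a semi-invariant of weight `2 Tr Q`. -/
theorem congrDer_det (Q : Matrix I I ℂ) :
    congrDer Q (genMat I).det = (2 * Q.trace) • (genMat I).det := by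
  rw [derivation_det, genMat_map_congrDer, Matrix.mul_add, trace_add, ← Matrix.mul_assoc,
    trace_mul_comm, ← Matrix.mul_assoc, mul_adjugate, ← Matrix.mul_assoc, adjugate_mul]
  simp only [Matrix.smul_mul, Matrix.one_mul, trace_smul, trace_transpose, trace_constMat,
    smul_eq_mul, MvPolynomial.smul_eq_C_mul, map_mul, map_ofNat]
  ring

/-- The adjugate transforms like `det(x) x⁻¹`. -/
theorem adjugate_map_congrDer (Q : Matrix I I ℂ) :
    (genMat I).adjugate.map (congrDer Q) = (2 * Q.trace) • (genMat I).adjugate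
      - constMat Q * (genMat I).adjugate - (genMat I).adjugate * (constMat Q)ᵀ := by
  set x := genMat I
  set d := x.det with hd
  have hd0 : d ≠ 0 := det_mvPolynomialX_ne_zero I ℂ
  have h1 : x.map (congrDer Q) * x.adjugate + x * x.adjugate.map (congrDer Q)
      = (2 * Q.trace) • (d • (1 : Matrix I I (MvPolynomial (I × I) ℂ))) := by
    rw [← map_derivation_mul, mul_adjugate]
    ext1 a b
    by_cases hab : a = b
    · subst hab
      simp only [map_apply, Matrix.smul_apply, one_apply_eq, smul_eq_mul, mul_one]
      exact congrDer_det Q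
    · simp only [map_apply, Matrix.smul_apply, one_apply_ne hab, smul_zero, map_zero]
  -- Multiply by the adjugate and cancel the determinant.
  have h2 := congrArg (fun Y => x.adjugate * Y) h1
  simp only [x, genMat_map_congrDer, Matrix.mul_add, Matrix.add_mul] at h2
  have e1 : x.adjugate * ((constMat Q)ᵀ * x * x.adjugate) = d • (x.adjugate * (constMat Q)ᵀ) := by
    rw [Matrix.mul_assoc, mul_adjugate]; simp [hd]
  have e2 : x.adjugate * (x * constMat Q * x.adjugate) = d • (constMat Q * x.adjugate) := by
    rw [Matrix.mul_assoc, ← Matrix.mul_assoc, adjugate_mul]; simp [hd]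
  have e3 : x.adjugate * (x * x.adjugate.map (congrDer Q)) = d • x.adjugate.map (congrDer Q) := by
    rw [← Matrix.mul_assoc, adjugate_mul]; simp [hd]
  rw [e1, e2, e3] at h2
  have h3 : d • x.adjugate.map (congrDer Q) = d • ((2 * Q.trace) • x.adjugate
      - constMat Q * x.adjugate - x.adjugate * (constMat Q)ᵀ) := by
    have e4 : x.adjugate * (2 * Q.trace) • d • (1 : Matrix I I (MvPolynomial (I × I) ℂ)) =
        d • (2 * Q.trace) • x.adjugate := by
      rw [Matrix.mul_smul, Matrix.mul_smul, Matrix.mul_one, smul_comm]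
    rw [smul_sub, smul_sub, ← e4, ← h2]
    abel
  ext1 a b
  have := congrFun₂ h3 a b
  exact mul_left_cancel₀ hd0 this

/-- The symmetric matrix unit `E_{ab} + E_{ba}`. -/
noncomputable def symUnit (a b : I) : Matrix I I ℂ := single a b 1 + single b a 1

/-- The second order differential operator through which a lowering operator, given by the symmetric
matrix `C`, acts on `f(R) v` when `v` has Levi weight `w` and is killed by that operator
(`HasLeviWeight`): here `f` is a polynomial in the raising
operators `R`. -/
noncomputable def loweringOp (w : ℂ) (C : Matrix I I ℂ) (f : MvPolynomial (I × I) ℂ) :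
    MvPolynomial (I × I) ℂ :=
  - ∑ p : I × I, (w * (2 * C p.1 p.2)) • MvPolynomial.pderiv p f
    - (1 / 2 : ℂ) • ∑ p : I × I, congrDer (symUnit p.1 p.2 * C) (MvPolynomial.pderiv p f)

theorem trace_symUnit_mul {C : Matrix I I ℂ} (hC : C.IsSymm) (a b : I) :
    (symUnit a b * C).trace = 2 * C a b := by
  rw [symUnit, Matrix.add_mul, trace_add, trace_single_mul, trace_single_mul, hC.apply a b]
  simp [two_mul]

/-- The value of the lowering operator on the determinant is a multiple of a linear combination of
first minors; it is an infinitesimal form of Cayley's identity. -/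
theorem loweringOp_det (w : ℂ) {C : Matrix I I ℂ} (hC : C.IsSymm) :
    loweringOp w C (genMat I).det =
      (-(2 * w - (Fintype.card I - 1))) • (constMat C * (genMat I).adjugate).trace := by
  set x := genMat I
  have tr1 : (constMat C * x.adjugate).trace = ∑ p : I × I, C p.1 p.2 • x.adjugate p.2 p.1 := by
    simp [trace, mul_apply, Fintype.sum_prod_type, MvPolynomial.smul_eq_C_mul]
  have key : ∀ a b, congrDer (symUnit a b * C) (x.adjugate b a) = (4 : ℂ) • C a b • x.adjugate b a
      - ((if a = b then (constMat C * x.adjugate) a a else 0) + (constMat C * x.adjugate) a a)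
      - ((x.adjugate * constMat C) b b
        + (if a = b then (x.adjugate * constMat C) a a else 0)) := by
    intro a b
    have h := congrFun₂ (adjugate_map_congrDer (symUnit a b * C)) b a
    have hc : constMat (symUnit a b * C) = (single a b 1 + single b a 1) * constMat C := by
      rw [constMat, Matrix.map_mul, symUnit, Matrix.map_add _ (map_add _)]
      simp [Matrix.map_single]
    have hct : (constMat C)ᵀ = constMat C := by rw [constMat, ← transpose_map, hC]
    rw [hc, transpose_mul, transpose_add, transpose_single, transpose_single, hct,
      trace_symUnit_mul hC, Matrix.mul_assoc, ← Matrix.mul_assoc (genMat I).adjugate] at h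
    refine h.trans ?_
    simp only [Matrix.sub_apply, Matrix.smul_apply, Matrix.add_mul, Matrix.mul_add,
      Matrix.add_apply, x]
    congr 2
    · module
    · congr 1
      · split_ifs with hab
        · subst hab; simp
        · rw [single_mul_apply_of_ne _ _ _ _ _ (Ne.symm hab)]
      · simp
    · simp
    · split_ifs with hab
      · subst hab; simp
      · rw [mul_single_apply_of_ne _ _ _ _ _ hab]
  have sums : ∑ p : I × I, congrDer (symUnit p.1 p.2 * C) (x.adjugate p.2 p.1) =
      (-(2 * ((Fintype.card I : ℂ) - 1))) • (constMat C * x.adjugate).trace := by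
    simp only [key, Finset.sum_sub_distrib, ← Finset.smul_sum, ← tr1, Finset.sum_add_distrib]
    have s1 : ∀ Y : Matrix I I (MvPolynomial (I × I) ℂ),
        ∑ p : I × I, (if p.1 = p.2 then Y p.1 p.1 else 0) = Y.trace := by
      intro Y
      simp [Fintype.sum_prod_type, trace]
    have s2 : ∀ Y : Matrix I I (MvPolynomial (I × I) ℂ),
        ∑ p : I × I, Y p.1 p.1 = (Fintype.card I : ℂ) • Y.trace := by
      intro Y
      simp [Fintype.sum_prod_type, trace, Nat.cast_smul_eq_nsmul, Finset.smul_sum]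
    have s3 : ∀ Y : Matrix I I (MvPolynomial (I × I) ℂ),
        ∑ p : I × I, Y p.2 p.2 = (Fintype.card I : ℂ) • Y.trace := by
      intro Y
      simp [Fintype.sum_prod_type, trace, Nat.cast_smul_eq_nsmul]
    rw [s1, s1, s2, s3, trace_mul_comm x.adjugate]
    module
  rw [loweringOp]
  have hp : ∀ p : I × I, MvPolynomial.pderiv p x.det = x.adjugate p.2 p.1 :=
    fun p => pderiv_det_genMat p.1 p.2
  simp only [hp, sums, mul_smul, ← Finset.smul_sum, ← tr1]
  module

theorem congrDer_symUnit_mul_X (C : Matrix I I ℂ)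
    (a b c d : I) :
    congrDer (symUnit c d * C) (MvPolynomial.X (a, b)) =
      C c a • MvPolynomial.X (d, b) + C d a • MvPolynomial.X (c, b) +
        (C c b • MvPolynomial.X (a, d) + C d b • MvPolynomial.X (a, c)) := by
  have h : ∀ e f, (symUnit c d * C) e f =
      (if e = d then C c f else 0) + (if e = c then C d f else 0) := by
    intro e f
    simp [symUnit, mul_apply, single_apply, add_mul, ite_and, Finset.sum_add_distrib, eq_comm,
      add_comm]
  rw [congrDer, MvPolynomial.mkDerivation_X]
  generalize symUnit c d * C = Q at h
  simp only [Matrix.add_apply, mul_apply, transpose_apply, map_apply, h, mvPolynomialX_apply,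
    map_add, apply_ite MvPolynomial.C, map_zero, add_mul, mul_add, ite_mul, mul_ite, zero_mul,
    mul_zero, Finset.sum_add_distrib, Finset.sum_ite_eq', Finset.mem_univ, if_true,
    MvPolynomial.smul_eq_C_mul]
  ring

theorem derivation_eq_sum_pderiv (δ : Derivation ℂ (MvPolynomial (I × I) ℂ) (MvPolynomial (I × I) ℂ))
    (f : MvPolynomial (I × I) ℂ) :
    δ f = ∑ q : I × I, δ (MvPolynomial.X q) * MvPolynomial.pderiv q f := by
  have hsum : ∀ g, (∑ q : I × I, δ (MvPolynomial.X q) • MvPolynomial.pderiv q) g =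
      ∑ q : I × I, δ (MvPolynomial.X q) * MvPolynomial.pderiv q g := by
    intro g
    rw [← Derivation.coeFnAddMonoidHom_apply, map_sum, Finset.sum_apply]
    rfl
  have h : δ = ∑ q : I × I, δ (MvPolynomial.X q) • MvPolynomial.pderiv q := by
    refine MvPolynomial.derivation_ext fun i => ?_
    simp [hsum, MvPolynomial.pderiv_X, Pi.single_apply]
  rw [← hsum, ← h]

theorem loweringOp_add (w : ℂ) (C : Matrix I I ℂ) (f g : MvPolynomial (I × I) ℂ) :
    loweringOp w C (f + g) = loweringOp w C f + loweringOp w C g := by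
  simp only [loweringOp, map_add, smul_add, Finset.sum_add_distrib]
  module

theorem loweringOp_C (w : ℂ) (C : Matrix I I ℂ) (c : ℂ) :
    loweringOp w C (MvPolynomial.C c) = 0 := by
  simp [loweringOp]

theorem loweringOp_X_mul (w : ℂ) (C : Matrix I I ℂ) (i : I × I) (f : MvPolynomial (I × I) ℂ) :
    loweringOp w C (MvPolynomial.X i * f) = MvPolynomial.X i * loweringOp w C f
      - (w * (2 * C i.1 i.2)) • f
      - (1 / 2 : ℂ) • (congrDer (symUnit i.1 i.2 * C) f + ∑ q : I × I,
          congrDer (symUnit q.1 q.2 * C) (MvPolynomial.X i) * MvPolynomial.pderiv q f) := by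
  have h1 : ∀ q : I × I, MvPolynomial.pderiv q (MvPolynomial.X i * f) =
      (if q = i then f else 0) + MvPolynomial.X i * MvPolynomial.pderiv q f := by
    intro q
    rw [Derivation.leibniz, MvPolynomial.pderiv_X, Pi.single_apply]
    simp only [smul_eq_mul, mul_ite, mul_one, mul_zero, eq_comm, add_comm]
  have h2 : ∀ q : I × I, congrDer (symUnit q.1 q.2 * C)
      ((if q = i then f else 0) + MvPolynomial.X i * MvPolynomial.pderiv q f) =
      (if q = i then congrDer (symUnit q.1 q.2 * C) f else 0)
      + (congrDer (symUnit q.1 q.2 * C) (MvPolynomial.X i) * MvPolynomial.pderiv q f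
      + MvPolynomial.X i * congrDer (symUnit q.1 q.2 * C) (MvPolynomial.pderiv q f)) := by
    intro q
    rw [map_add, Derivation.leibniz, apply_ite (congrDer (symUnit q.1 q.2 * C)), map_zero,
      smul_eq_mul, smul_eq_mul]
    ring
  simp only [loweringOp, h1, h2, smul_add, Finset.sum_add_distrib, smul_ite, smul_zero,
    Finset.sum_ite_eq', Finset.mem_univ, if_true, mul_sub, mul_neg, Finset.mul_sum, mul_smul_comm]
  module

end Generic

/-! ### Brackets in the Jacobi Lie algebra -/

section LieAlgebra

variable {n j : ℕ}

theorem raising_eq_upper (a b : Fin n ⊕ Fin j) :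
    ((raising a b : jacobiLieAlgebra n j) : Matrix (Idx n j) (Idx n j) ℂ) =
      fromBlocks 0 (symUnit a b) 0 0 := rfl

theorem raising_comm (a b : Fin n ⊕ Fin j) : raising a b = raising b a := by
  apply Subtype.ext
  simp only [raising, add_comm]

/-- The element `diag(Q, -Qᵀ)` of `𝔤^{(n,j)}`, where `Q` has first block column `(A, lam)` and second
block column zero. -/
noncomputable def levi (A : Matrix (Fin n) (Fin n) ℂ) (lam : Matrix (Fin j) (Fin n) ℂ) :
    jacobiLieAlgebra n j :=
  elt A 0 0 lam 0 0 isSymm_zero isSymm_zero isSymm_zero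

/-- The matrix `Q` of `levi A lam`. -/
def leviBlock (A : Matrix (Fin n) (Fin n) ℂ) (lam : Matrix (Fin j) (Fin n) ℂ) :
    Matrix (Fin n ⊕ Fin j) (Fin n ⊕ Fin j) ℂ :=
  fromBlocks A 0 lam 0

theorem coe_levi (A : Matrix (Fin n) (Fin n) ℂ) (lam : Matrix (Fin j) (Fin n) ℂ) :
    (levi A lam : Matrix (Idx n j) (Idx n j) ℂ) =
      fromBlocks (leviBlock A lam) 0 0 (-(leviBlock A lam)ᵀ) := by
  simp [levi, elt, blockMatrix, leviBlock, fromBlocks_transpose, fromBlocks_neg]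

theorem trace_leviBlock (A : Matrix (Fin n) (Fin n) ℂ) (lam : Matrix (Fin j) (Fin n) ℂ) :
    (leviBlock A lam).trace = A.trace := by
  simp [leviBlock, trace, Fintype.sum_sum_type]

theorem levi_lie_raising (A : Matrix (Fin n) (Fin n) ℂ) (lam : Matrix (Fin j) (Fin n) ℂ)
    (a b : Fin n ⊕ Fin j) :
    ⁅levi A lam, raising a b⁆ = ∑ c, (leviBlock A lam c a • raising c b
      + leviBlock A lam c b • raising a c) := by
  apply Subtype.ext
  set Q := leviBlock A lam with hQ
  have h : Q * symUnit a b + symUnit a b * Qᵀ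
      = ∑ c, (Q c a • symUnit c b + Q c b • symUnit a c) := by
    ext e f
    simp [symUnit, mul_apply, Matrix.sum_apply, single_apply, Finset.sum_add_distrib, mul_add,
      add_mul, ite_and]
    abel
  have hs : ((∑ c, (Q c a • raising c b + Q c b • raising a c) : jacobiLieAlgebra n j) :
      Matrix (Idx n j) (Idx n j) ℂ) = fromBlocks 0 (Q * symUnit a b + symUnit a b * Qᵀ) 0 0 := by
    rw [h]
    ext e f
    rcases e with e | e <;> rcases f with f | f <;>
      simp [Matrix.sum_apply, raising_eq_upper]
  rw [hs, LieSubalgebra.coe_bracket, coe_levi, raising_eq_upper, Ring.lie_def, ← hQ]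
  simp [fromBlocks_multiply, sub_eq_add_neg, fromBlocks_add, fromBlocks_neg]

/-- The `n × n` matrix `C`, extended by zero to size `n + j`. -/
def lowerBlock (j : ℕ) (C : Matrix (Fin n) (Fin n) ℂ) :
    Matrix (Fin n ⊕ Fin j) (Fin n ⊕ Fin j) ℂ :=
  fromBlocks C 0 0 0

theorem lowerBlock_isSymm {C : Matrix (Fin n) (Fin n) ℂ} (hC : C.IsSymm) :
    (lowerBlock j C).IsSymm :=
  hC.fromBlocks (by simp) isSymm_zero

theorem lowerBlock_symUnit (a b : Fin n) :
    lowerBlock j (symUnit a b) = symUnit (Sum.inl a) (Sum.inl b) := by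
  ext (e | e) (f | f) <;> simp [lowerBlock, symUnit, single_apply]

theorem leviBlock_symUnit_mul (C : Matrix (Fin n) (Fin n) ℂ) (a b : Fin n ⊕ Fin j) :
    leviBlock (symUnit a b * lowerBlock j C).toBlocks₁₁ (symUnit a b * lowerBlock j C).toBlocks₂₁ =
      symUnit a b * lowerBlock j C := by
  conv_rhs => rw [← fromBlocks_toBlocks (symUnit a b * lowerBlock j C)]
  rw [leviBlock]
  congr 1 <;> ext e f <;>
    simp [toBlocks₁₂, toBlocks₂₂, lowerBlock, mul_apply, Fintype.sum_sum_type]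

theorem lower_lie_raising (C : Matrix (Fin n) (Fin n) ℂ) (hC : C.IsSymm) (a b : Fin n ⊕ Fin j) :
    ⁅(sp 0 0 C isSymm_zero hC : jacobiLieAlgebra n j), raising a b⁆ =
      -levi (symUnit a b * lowerBlock j C).toBlocks₁₁ (symUnit a b * lowerBlock j C).toBlocks₂₁ := by
  apply Subtype.ext
  have h1 : ((sp 0 0 C isSymm_zero hC : jacobiLieAlgebra n j) : Matrix (Idx n j) (Idx n j) ℂ) =
      fromBlocks 0 0 (lowerBlock j C) 0 := by
    simp [sp, elt, blockMatrix, lowerBlock]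
  have h2 : (symUnit a b)ᵀ = symUnit a b := by simp [symUnit, add_comm]
  rw [LieSubalgebra.coe_bracket, h1, raising_eq_upper, Ring.lie_def, NegMemClass.coe_neg, coe_levi,
    leviBlock_symUnit_mul, transpose_mul, h2, lowerBlock_isSymm hC]
  simp [fromBlocks_multiply, sub_eq_add_neg, fromBlocks_add, fromBlocks_neg]

theorem heis_lie_raising (ζ : Matrix (Fin j) (Fin j) ℂ) (hζ : ζ.IsSymm) (a b : Fin n ⊕ Fin j) :
    ⁅(heis 0 0 ζ hζ : jacobiLieAlgebra n j), raising a b⁆ = 0 := by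
  apply Subtype.ext
  have h1 : ((heis 0 0 ζ hζ : jacobiLieAlgebra n j) : Matrix (Idx n j) (Idx n j) ℂ) =
      fromBlocks 0 (fromBlocks 0 0 0 ζ) 0 0 := by
    simp [heis, elt, blockMatrix]
  rw [LieSubalgebra.coe_bracket, h1, raising_eq_upper, Ring.lie_def]
  simp [fromBlocks_multiply]

theorem symUnit_isSymm {I : Type*} [DecidableEq I] (a b : I) : (symUnit a b).IsSymm := by
  simp [IsSymm, symUnit, add_comm]

theorem raising_inr_inr (a b : Fin j) :
    (raising (Sum.inr a) (Sum.inr b) : jacobiLieAlgebra n j) =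
      heis 0 0 (symUnit a b) (symUnit_isSymm a b) := by
  apply Subtype.ext
  rw [raising_eq_upper]
  simp only [heis, elt, blockMatrix]
  ext (e | e) (f | f)
  · simp [fromBlocks]
    rcases e with e | e <;> rcases f with f | f <;> simp
  · rcases e with e | e <;> rcases f with f | f <;> simp [symUnit, single_apply]
  · rcases e with e | e <;> rcases f with f | f <;> simp
  · rcases e with e | e <;> rcases f with f | f <;> simp

end LieAlgebra

/-! ### The algebra of raising operators -/

section Polynomials

variable (n j : ℕ)

/-- The commutative subalgebra of the enveloping algebra generated by the raising operators. -/
noncomputable abbrev raisingAlgebra : Subalgebra ℂ (U n j) :=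
  Algebra.adjoin ℂ (Set.range fun p : (Fin n ⊕ Fin j) × (Fin n ⊕ Fin j) => raisingMatrix p.1 p.2)

noncomputable instance raisingAlgebraCommRing : CommRing (raisingAlgebra n j) where
  toRing := inferInstance
  mul_comm := (Algebra.isMulCommutative_adjoin ℂ (by
    rintro _ ⟨p, rfl⟩ _ ⟨q, rfl⟩
    exact raisingMatrix_commute _ _ _ _)).is_comm.comm

/-- The entries of `raisingMatrix`, inside the commutative algebra they generate. -/
noncomputable def raisingEntry (p : (Fin n ⊕ Fin j) × (Fin n ⊕ Fin j)) : raisingAlgebra n j :=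
  ⟨raisingMatrix p.1 p.2, Algebra.subset_adjoin ⟨p, rfl⟩⟩

/-- Evaluation of polynomials at the raising operators. -/
noncomputable def evalRaising :
    MvPolynomial ((Fin n ⊕ Fin j) × (Fin n ⊕ Fin j)) ℂ →ₐ[ℂ] raisingAlgebra n j :=
  MvPolynomial.aeval (raisingEntry n j)

theorem raisingOp_eq_eval :
    raisingOp n j = evalRaising n j (genMat (Fin n ⊕ Fin j)).det := by
  rw [det_apply, map_sum, raisingOp, AddSubmonoidClass.coe_finsetSum]
  refine Finset.sum_congr rfl fun σ _ => ?_
  rw [Units.smul_def, map_zsmul, map_prod, ← Finset.noncommProd_eq_prod]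
  rw [SetLike.val_smul_of_tower]
  congr 1
  refine Eq.trans ?_ (Finset.map_noncommProd _ _ _ (raisingAlgebra n j).val).symm
  refine Finset.noncommProd_congr rfl (fun i _ => ?_) _
  simp [evalRaising, raisingEntry]

theorem evalRaising_adjugate_comm (a b : Fin n ⊕ Fin j) :
    evalRaising n j ((genMat (Fin n ⊕ Fin j)).adjugate a b) =
      evalRaising n j ((genMat (Fin n ⊕ Fin j)).adjugate b a) := by
  have hs : ((genMat (Fin n ⊕ Fin j)).map (evalRaising n j)).IsSymm := by
    ext1 a b
    apply Subtype.ext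
    simp [evalRaising, raisingEntry, raisingMatrix, raising_comm a b]
  have h := (evalRaising n j).map_adjugate (genMat (Fin n ⊕ Fin j))
  have ha := hs.adjugate.apply b a
  rw [← AlgHom.mapMatrix_apply, ← h] at ha
  exact ha

end Polynomials

/-! ### Polynomials in the raising operators on a module -/

section Module

variable (n j : ℕ) (V : Type*) [AddCommGroup V] [Module ℂ V]
    [LieRingModule (jacobiLieAlgebra n j) V] [LieModule ℂ (jacobiLieAlgebra n j) V]

/-- The action on a `𝔤^{(n,j)}`-module of polynomials in the raising operators. -/
noncomputable def polyAct :
    MvPolynomial ((Fin n ⊕ Fin j) × (Fin n ⊕ Fin j)) ℂ →ₐ[ℂ] Module.End ℂ V :=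
  ((act n j).comp (raisingAlgebra n j).val).comp (evalRaising n j)

variable {n j V}

theorem polyAct_X (p : (Fin n ⊕ Fin j) × (Fin n ⊕ Fin j)) (v : V) :
    polyAct n j V (MvPolynomial.X p) v = ⁅raising p.1 p.2, v⁆ := by
  simp [polyAct, evalRaising, raisingEntry, raisingMatrix, act]

theorem polyAct_lie_raising (f : MvPolynomial ((Fin n ⊕ Fin j) × (Fin n ⊕ Fin j)) ℂ)
    (a b : Fin n ⊕ Fin j) (v : V) :
    polyAct n j V f ⁅raising a b, v⁆ = ⁅raising a b, polyAct n j V f v⁆ := by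
  rw [← polyAct_X (a, b), ← polyAct_X (a, b), ← Module.End.mul_apply, ← Module.End.mul_apply,
    ← map_mul, ← map_mul, mul_comm]

theorem polyAct_X_comm (a b : Fin n ⊕ Fin j) :
    polyAct n j V (MvPolynomial.X (a, b)) = polyAct n j V (MvPolynomial.X (b, a)) := by
  ext v
  rw [polyAct_X, polyAct_X, raising_comm]

theorem polyAct_adjugate_comm (a b : Fin n ⊕ Fin j) :
    polyAct n j V ((genMat (Fin n ⊕ Fin j)).adjugate a b) =
      polyAct n j V ((genMat (Fin n ⊕ Fin j)).adjugate b a) := by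
  simp only [polyAct, AlgHom.comp_apply, evalRaising_adjugate_comm n j a b]

theorem act_raisingOp_pow (k : ℕ) (v : V) :
    act n j (raisingOp n j ^ k) v = polyAct n j V ((genMat (Fin n ⊕ Fin j)).det ^ k) v := by
  rw [raisingOp_eq_eval]
  simp [polyAct]

theorem heis_lie_polyAct (ζ : Matrix (Fin j) (Fin j) ℂ) (hζ : ζ.IsSymm)
    (f : MvPolynomial ((Fin n ⊕ Fin j) × (Fin n ⊕ Fin j)) ℂ) (v : V) :
    ⁅(heis 0 0 ζ hζ : jacobiLieAlgebra n j), polyAct n j V f v⁆ =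
      polyAct n j V f ⁅(heis 0 0 ζ hζ : jacobiLieAlgebra n j), v⁆ := by
  induction f using MvPolynomial.induction_on generalizing v with
  | C c => simp [MvPolynomial.C_eq_smul_one]
  | add p q hp hq => simp [hp, hq]
  | mul_X p i hp =>
    simp only [map_mul, Module.End.mul_apply, hp, polyAct_X]
    rw [leibniz_lie, heis_lie_raising, zero_lie, zero_add]

theorem levi_lie_polyAct (A : Matrix (Fin n) (Fin n) ℂ) (lam : Matrix (Fin j) (Fin n) ℂ)
    (f : MvPolynomial ((Fin n ⊕ Fin j) × (Fin n ⊕ Fin j)) ℂ) (v : V) :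
    ⁅levi A lam, polyAct n j V f v⁆ = polyAct n j V f ⁅levi A lam, v⁆ +
      polyAct n j V (congrDer (leviBlock A lam) f) v := by
  induction f using MvPolynomial.induction_on generalizing v with
  | C c => simp [MvPolynomial.C_eq_smul_one]
  | add p q hp hq =>
    simp only [map_add, LinearMap.add_apply, lie_add, hp, hq]
    abel
  | mul_X p i hp =>
    have h : ⁅⁅levi A lam, raising i.1 i.2⁆, v⁆ =
        polyAct n j V (congrDer (leviBlock A lam) (MvPolynomial.X i)) v := by
      rw [levi_lie_raising, congrDer, MvPolynomial.mkDerivation_X]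
      simp [mul_apply, polyAct_X, Finset.sum_add_distrib, sum_lie, mul_comm]
    rw [map_mul, Module.End.mul_apply, hp, polyAct_X, leibniz_lie, h, map_add, Derivation.leibniz]
    simp only [smul_eq_mul, map_add, LinearMap.add_apply, map_mul, Module.End.mul_apply, polyAct_X]
    rw [polyAct_lie_raising (congrDer (leviBlock A lam) p)]
    abel

/-- Every element `diag(Q, -Qᵀ)` of `𝔤^{(n,j)}` acts on `v` by `w Tr Q`: this combines weight `w` with
the first half of holomorphy. -/
def HasLeviWeight (n j : ℕ) {V : Type*} [AddCommGroup V] [Module ℂ V]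
    [LieRingModule (jacobiLieAlgebra n j) V] (w : ℂ) (v : V) : Prop :=
  ∀ (A : Matrix (Fin n) (Fin n) ℂ) (lam : Matrix (Fin j) (Fin n) ℂ),
    ⁅(levi A lam : jacobiLieAlgebra n j), v⁆ = (w * A.trace) • v

theorem hasLeviWeight_iff {V : Type*} [AddCommGroup V] [Module ℂ V]
    [LieRingModule (jacobiLieAlgebra n j) V] {w : ℂ} {v : V} : HasLeviWeight n j w v ↔
    HasWeight n j w v ∧ ∀ lam : Matrix (Fin j) (Fin n) ℂ,
      ⁅(heis lam 0 0 isSymm_zero : jacobiLieAlgebra n j), v⁆ = 0 := by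
  constructor
  · intro h
    refine ⟨fun A => h A 0, fun lam => ?_⟩
    have := h 0 lam
    rwa [trace_zero, mul_zero, zero_smul] at this
  · rintro ⟨h1, h2⟩ A lam
    have : (levi A lam : jacobiLieAlgebra n j) =
        sp A 0 0 isSymm_zero isSymm_zero + heis lam 0 0 isSymm_zero := by
      apply Subtype.ext
      simp [levi, sp, heis, elt, blockMatrix, fromBlocks_add]
    rw [this, add_lie, h1, h2, add_zero]

theorem HasLeviWeight.polyAct_det_pow {w : ℂ} {v : V} (h : HasLeviWeight n j w v) (k : ℕ) :
    HasLeviWeight n j (w + 2 * k) (polyAct n j V ((genMat (Fin n ⊕ Fin j)).det ^ k) v) := by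
  intro A lam
  have hd : congrDer (leviBlock A lam) ((genMat (Fin n ⊕ Fin j)).det ^ k) =
      (2 * k * A.trace) • (genMat (Fin n ⊕ Fin j)).det ^ k := by
    rw [Derivation.leibniz_pow, congrDer_det, trace_leviBlock]
    cases k with
    | zero => simp
    | succ k =>
      rw [Nat.add_sub_cancel, ← Nat.cast_smul_eq_nsmul ℂ, smul_eq_mul, mul_smul_comm, ← pow_succ,
        smul_smul]
      congr 1
      ring
  rw [levi_lie_polyAct, h, hd, map_smul, map_smul, LinearMap.smul_apply]
  module

theorem HasIndex.polyAct {M : Matrix (Fin j) (Fin j) ℂ} {v : V} (h : HasIndex n j M v)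
    (f : MvPolynomial ((Fin n ⊕ Fin j) × (Fin n ⊕ Fin j)) ℂ) :
    HasIndex n j M (polyAct n j V f v) := by
  intro ζ hζ
  rw [heis_lie_polyAct, h, map_smul]

/-- On a vector of Levi weight `w`, commuting a lowering operator past a polynomial in the raising
operators produces the differential operator `loweringOp w`. -/
theorem HasLeviWeight.lower_lie_polyAct {w : ℂ} {v : V} (h : HasLeviWeight n j w v)
    (C : Matrix (Fin n) (Fin n) ℂ) (hC : C.IsSymm)
    (f : MvPolynomial ((Fin n ⊕ Fin j) × (Fin n ⊕ Fin j)) ℂ) :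
    ⁅(sp 0 0 C isSymm_zero hC : jacobiLieAlgebra n j), polyAct n j V f v⁆ =
      polyAct n j V f ⁅(sp 0 0 C isSymm_zero hC : jacobiLieAlgebra n j), v⁆ +
        polyAct n j V (loweringOp w (lowerBlock j C) f) v := by
  induction f using MvPolynomial.induction_on with
  | C c => rw [loweringOp_C]; simp [MvPolynomial.C_eq_smul_one]
  | add p q hp hq =>
    simp only [loweringOp_add, map_add, LinearMap.add_apply, lie_add, hp, hq]
    abel
  | mul_X p i hp =>
    set C' := lowerBlock j C
    have hC' : C'.IsSymm := lowerBlock_isSymm hC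
    -- The coefficients of the second order part are symmetric, because the raising operators are.
    have hsymm : ∀ q : (Fin n ⊕ Fin j) × (Fin n ⊕ Fin j),
        polyAct n j V (congrDer (symUnit q.1 q.2 * C') (MvPolynomial.X i)) =
          polyAct n j V (congrDer (symUnit i.1 i.2 * C') (MvPolynomial.X q)) := by
      rintro ⟨c, d⟩
      obtain ⟨a, b⟩ := i
      rw [congrDer_symUnit_mul_X, congrDer_symUnit_mul_X]
      simp only [map_add, map_smul, hC'.apply a c, hC'.apply b c, hC'.apply a d, hC'.apply b d,
        polyAct_X_comm d b, polyAct_X_comm a c]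
      abel
    have hsum : polyAct n j V (∑ q, congrDer (symUnit q.1 q.2 * C') (MvPolynomial.X i) *
        MvPolynomial.pderiv q p) = polyAct n j V (congrDer (symUnit i.1 i.2 * C') p) := by
      rw [derivation_eq_sum_pderiv (congrDer (symUnit i.1 i.2 * C')) p, map_sum, map_sum]
      exact Finset.sum_congr rfl fun q _ => by rw [map_mul, map_mul, hsymm]
    have hl := levi_lie_polyAct (symUnit i.1 i.2 * C').toBlocks₁₁ (symUnit i.1 i.2 * C').toBlocks₂₁
      p v
    rw [h, leviBlock_symUnit_mul, ← trace_leviBlock _ (symUnit i.1 i.2 * C').toBlocks₂₁,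
      leviBlock_symUnit_mul, trace_symUnit_mul hC'] at hl
    rw [mul_comm, loweringOp_X_mul, map_mul, Module.End.mul_apply, polyAct_X, leibniz_lie, hp,
      lower_lie_raising, neg_lie, hl]
    simp only [map_sub, map_smul, map_add, hsum, LinearMap.sub_apply, LinearMap.smul_apply,
      LinearMap.add_apply, map_mul, Module.End.mul_apply, polyAct_X, lie_add]
    module

/-- A lowering operator that kills a vector `v` of Levi weight `w` maps `det(R)^(k+1) v` to an explicit
multiple of a combination of first minors applied to `det(R)^k v`. -/
theorem HasLeviWeight.lower_lie_polyAct_det_pow {w : ℂ} {v : V} (h : HasLeviWeight n j w v)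
    (C : Matrix (Fin n) (Fin n) ℂ) (hC : C.IsSymm)
    (hv : ⁅(sp 0 0 C isSymm_zero hC : jacobiLieAlgebra n j), v⁆ = 0) (k : ℕ) :
    ⁅(sp 0 0 C isSymm_zero hC : jacobiLieAlgebra n j),
        polyAct n j V ((genMat (Fin n ⊕ Fin j)).det ^ (k + 1)) v⁆ =
      (-(2 * (k + 1) * (w + k - (n + j - 1) / 2)) : ℂ) •
        polyAct n j V ((constMat (lowerBlock j C) * (genMat (Fin n ⊕ Fin j)).adjugate).trace *
          (genMat (Fin n ⊕ Fin j)).det ^ k) v := by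
  induction k with
  | zero =>
    rw [h.lower_lie_polyAct, hv, pow_zero, mul_one, zero_add, pow_one,
      loweringOp_det _ (lowerBlock_isSymm hC)]
    simp only [map_zero, map_smul, LinearMap.smul_apply, Fintype.card_sum, Fintype.card_fin,
      zero_add]
    push_cast
    module
  | succ k ih =>
    rw [pow_succ' _ (k + 1), map_mul, Module.End.mul_apply,
      (h.polyAct_det_pow (k + 1)).lower_lie_polyAct, ih, loweringOp_det _ (lowerBlock_isSymm hC)]
    rw [map_smul, map_smul, ← Module.End.mul_apply, ← map_mul, LinearMap.smul_apply,
      ← Module.End.mul_apply, ← map_mul, mul_left_comm, ← pow_succ']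
    simp only [Fintype.card_sum, Fintype.card_fin]
    push_cast
    module

/-- If the lower right block of the raising operators acts on `v` by an invertible matrix of scalars
and the upper left `n × n` block of the adjugate kills `v`, then so does the determinant. -/
theorem polyAct_det_eq_zero (hn : 0 < n) {M : Matrix (Fin j) (Fin j) ℂ} (hM : M.IsSymm)
    (hdet : M.det ≠ 0) {v : V} (hind : HasIndex n j M v)
    (hadj : ∀ a b : Fin n,
      polyAct n j V ((genMat (Fin n ⊕ Fin j)).adjugate (Sum.inl a) (Sum.inl b)) v = 0) :
    polyAct n j V (genMat (Fin n ⊕ Fin j)).det v = 0 := by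
  set x := genMat (Fin n ⊕ Fin j)
  let a : Fin n := ⟨0, hn⟩
  have hexp : ∀ c, polyAct n j V ((x * x.adjugate) c (Sum.inl a)) v =
      ∑ d : Fin j, polyAct n j V (x c (Sum.inr d))
        (polyAct n j V (x.adjugate (Sum.inr d) (Sum.inl a)) v) := by
    intro c
    rw [mul_apply, map_sum, Fintype.sum_sum_type, LinearMap.add_apply]
    simp [hadj]
  have hR : ∀ (c d : Fin j) (f : MvPolynomial ((Fin n ⊕ Fin j) × (Fin n ⊕ Fin j)) ℂ),
      polyAct n j V (x (Sum.inr c) (Sum.inr d)) (polyAct n j V f v) =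
        (4 * Real.pi * Complex.I * M c d : ℂ) • polyAct n j V f v := by
    intro c d f
    have h := polyAct_X (n := n) (Sum.inr c, Sum.inr d) (polyAct n j V f v)
    rw [raising_inr_inr, hind.polyAct f, trace_symUnit_mul hM] at h
    refine h.trans ?_
    congr 1
    ring
  -- The entries `(c, a)` of `x * adj x = det x`, for `c` in the second block.
  have hrow : ∀ c : Fin j,
      ∑ d : Fin j, M c d • polyAct n j V (x.adjugate (Sum.inr d) (Sum.inl a)) v = 0 := by
    intro c
    have h := hexp (Sum.inr c)
    rw [mul_adjugate, Matrix.smul_apply, one_apply_ne (by simp), smul_zero, map_zero,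
      LinearMap.zero_apply] at h
    simp only [hR, mul_smul _ (M c _), ← Finset.smul_sum] at h
    refine (smul_eq_zero.mp h.symm).resolve_left ?_
    simp [Real.pi_ne_zero]
  have hcol : ∀ d : Fin j, polyAct n j V (x.adjugate (Sum.inr d) (Sum.inl a)) v = 0 := by
    intro d
    have h : ∑ c, M⁻¹ d c • ∑ e : Fin j,
        M c e • polyAct n j V (x.adjugate (Sum.inr e) (Sum.inl a)) v = 0 := by
      simp [hrow]
    simp only [Finset.smul_sum, smul_smul] at h
    rw [Finset.sum_comm] at h
    simp only [← Finset.sum_smul, ← mul_apply,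
      nonsing_inv_mul M (isUnit_iff_ne_zero.mpr hdet)] at h
    simpa [one_apply] using h
  have h := hexp (Sum.inl a)
  rw [mul_adjugate, Matrix.smul_apply, one_apply_eq, smul_eq_mul, mul_one] at h
  rw [h]
  simp [hcol]

end Module
end Jacobi

theorem mainTheorem3 (n j : ℕ) (hn : 0 < n)
    (V : Type*) [AddCommGroup V] [Module ℂ V]
    [LieRingModule (Jacobi.jacobiLieAlgebra n j) V]
    [LieModule ℂ (Jacobi.jacobiLieAlgebra n j) V]
    (M : Matrix (Fin j) (Fin j) ℂ) (hM : M.IsSymm) (r : ℕ) (v₀ : V)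
    (hhol : Jacobi.IsHolomorphic n j v₀)
    (hind : Jacobi.HasIndex n j M v₀)
    (hwt : Jacobi.HasWeight n j (-(r : ℂ) + ((n : ℂ) + (j : ℂ) + 1) / 2) v₀) :
    (Jacobi.IsHolomorphic n j (Jacobi.act n j (Jacobi.raisingOp n j ^ r) v₀) ∧
      Jacobi.HasIndex n j M (Jacobi.act n j (Jacobi.raisingOp n j ^ r) v₀) ∧
      Jacobi.HasWeight n j ((r : ℂ) + ((n : ℂ) + (j : ℂ) + 1) / 2)
        (Jacobi.act n j (Jacobi.raisingOp n j ^ r) v₀)) ∧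
    ∀ k : ℕ, k ≠ r →
      Jacobi.HasWeight n j (-(r : ℂ) + ((n : ℂ) + (j : ℂ) + 1) / 2 + 2 * (k : ℂ))
        (Jacobi.act n j (Jacobi.raisingOp n j ^ k) v₀) ∧
      Jacobi.HasIndex n j M (Jacobi.act n j (Jacobi.raisingOp n j ^ k) v₀) ∧
      (k ≠ 0 → M.det ≠ 0 → Jacobi.act n j (Jacobi.raisingOp n j ^ k) v₀ ≠ 0 →
        ¬ Jacobi.IsHolomorphic n j (Jacobi.act n j (Jacobi.raisingOp n j ^ k) v₀)) := by
  have hlw := Jacobi.hasLeviWeight_iff.mpr ⟨hwt, hhol.1⟩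
  have hpow := fun k => Jacobi.hasLeviWeight_iff.mp (hlw.polyAct_det_pow k)
  simp only [Jacobi.act_raisingOp_pow]
  refine ⟨⟨⟨(hpow r).2, fun X hX => ?_⟩, hind.polyAct _, ?_⟩, fun k hk =>
    ⟨(hpow k).1, hind.polyAct _, fun hk0 hdet hne hol => hne ?_⟩⟩
  · cases r with
    | zero => simpa using hhol.2 X hX
    | succ r =>
      rw [hlw.lower_lie_polyAct_det_pow X hX (hhol.2 X hX)]
      refine smul_eq_zero_of_left ?_ _
      push_cast
      ring
  · convert (hpow r).1 using 1
    ring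
  · obtain ⟨k, rfl⟩ := Nat.exists_eq_succ_of_ne_zero hk0
    rw [Nat.succ_eq_add_one, pow_succ', map_mul, Module.End.mul_apply]
    refine Jacobi.polyAct_det_eq_zero hn hM hdet (hind.polyAct _) fun a b => ?_
    -- The lowering operator of `E_{ab} + E_{ba}` isolates the minor `adj_{ab} = adj_{ba}`.
    have hs := Jacobi.symUnit_isSymm a b
    have h := hol.2 (Jacobi.symUnit a b) hs
    rw [hlw.lower_lie_polyAct_det_pow _ hs (hhol.2 _ hs)] at h
    have hc : (-(2 * (k + 1) * (-(r : ℂ) + ((n : ℂ) + (j : ℂ) + 1) / 2 + k - (n + j - 1) / 2)) : ℂ)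
        = 2 * (k + 1) * (r - (k + 1)) := by ring
    have hne' : (2 * (k + 1) * (r - (k + 1)) : ℂ) ≠ 0 := by
      refine mul_ne_zero (mul_ne_zero two_ne_zero (Nat.cast_add_one_ne_zero k)) ?_
      rw [sub_ne_zero]
      exact_mod_cast hk.symm
    rw [hc] at h
    have h' := (smul_eq_zero.mp h).resolve_left hne'
    have htr : (Jacobi.constMat (Jacobi.lowerBlock j (Jacobi.symUnit a b)) *
        (Jacobi.genMat (Fin n ⊕ Fin j)).adjugate).trace =
        (Jacobi.genMat (Fin n ⊕ Fin j)).adjugate (Sum.inl b) (Sum.inl a) +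
        (Jacobi.genMat (Fin n ⊕ Fin j)).adjugate (Sum.inl a) (Sum.inl b) := by
      have e : Jacobi.constMat (Jacobi.lowerBlock j (Jacobi.symUnit a b)) =
          Matrix.single (Sum.inl a) (Sum.inl b) 1 + Matrix.single (Sum.inl b) (Sum.inl a) 1 := by
        rw [Jacobi.lowerBlock_symUnit, Jacobi.constMat, Jacobi.symUnit,
          Matrix.map_add _ (map_add _)]
        simp [Matrix.map_single]
      rw [e, Matrix.add_mul, Matrix.trace_add, Matrix.trace_single_mul, Matrix.trace_single_mul]
      simp
    rw [htr, map_mul, map_add, Jacobi.polyAct_adjugate_comm (Sum.inl b), ← two_smul ℂ,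
      Module.End.mul_apply, LinearMap.smul_apply] at h'
    exact (smul_eq_zero.mp h').resolve_left two_ne_zero
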